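/- Let $\mathbb T$ be the unit circle with normalized Lebesgue measure $m$, let $L^2=L^2(\mathbb T,m)$, and let $H^2\subset L^2$ be the Hardy space of functions whose Fourier coefficients of negative index vanish. Let $u$ be a non-constant inner function (that is, $u\in H^2$ and $|u|=1$ a.e. on $\mathbb T$), let $K_u=H^2\ominus uH^2$ be the model space, and let $P_u$ be the orthogonal projection of $L^2$ onto $K_u$. For $\Phi\in L^2$ the truncated Toeplitz operator (TTO) with symbol $\Phi$ is $A_\Phi f=P_u(\Phi f)$, defined on the bounded functions $f\in K_u$ (which are dense in $K_u$). Let $\mathcal T_u$ be the set of TTOs that extend to bounded operators on $K_u$; such a TTO is identified with its extension, and $\Phi$ is called a symbol of $A$ if $A=A_\Phi$. For $f\in K_u$ put $Cf=u\,\overline{zf}\in K_u$ and $S_uf=P_u(zf)$. For $\alpha\in\mathbb C$, an operator $A\in\mathcal T_u$ is said to be of type $\alpha$ if it has a symbol of the form $\varphi+\alpha\,\overline{S_uC\varphi}+c$ with $\varphi\in K_u$ and $c\in\mathbb C$; it is said to be of type $\infty$ if it has an antiholomorphic symbol, that is, a symbol $\overline{\psi}$ with $\psi\in H^2$. Theorem.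 Let $\Phi,\Psi\in L^2$ be such that $A_\Phi,A_\Psi\in\mathcal T_u$. Then the product $A_\Phi A_\Psi$ of the bounded operators belongs to $\mathcal T_u$ if and only if one of the following two (not mutually exclusive) cases holds: (i) $A_\Phi$ or $A_\Psi$ is equal to $cI$ for some $c\in\mathbb C$; (ii) $A_\Phi$ and $A_\Psi$ are both of type $\alpha$ for some $\alpha$ in the Riemann sphere $\mathbb C\cup\{\infty\}$. Moreover, whenever $A_\Phi$ and $A_\Psi$ are both of type $\alpha$, for $\alpha\in\mathbb C\cup\{\infty\}$, the product $A_\Phi A_\Psi$ is of type $\alpha$ as well. -/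

import Mathlib

open MeasureTheory AddCircle
open scoped ENNReal

noncomputable section

namespace TTO

/-- The unit circle, parametrised as `ℝ / ℤ` through `t ↦ exp (2 π i t)`. -/
abbrev Torus : Type := AddCircle (1 : ℝ)

/-- Normalized Lebesgue (Haar probability) measure on the unit circle. -/
abbrev m : Measure Torus := haarAddCircle

/-- The Hilbert space `L²` of the circle. -/
abbrev L2 : Type := Lp ℂ 2 m

/-- The Hardy space `H²`: all `f ∈ L²` whose Fourier coefficients of negative index vanish. -/
def H2 : Submodule ℂ L2 where
  carrier := {f | ∀ n : ℤ, n < 0 → fourierCoeff (f : Torus → ℂ) n = 0}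
  zero_mem' := by
    intro n _
    rw [← fourierBasis_repr]
    simp
  add_mem' := by
    intro f g hf hg n hn
    have h1 := hf n hn
    have h2 := hg n hn
    rw [← fourierBasis_repr] at h1 h2 ⊢
    simp [h1, h2]
  smul_mem' := by
    intro c f hf n hn
    have h1 := hf n hn
    rw [← fourierBasis_repr] at h1 ⊢
    simp [h1]

theorem isClosed_H2 : IsClosed (H2 : Set L2) := by
  have h : (H2 : Set L2) =
      ⋂ n : ℤ, ⋂ _ : n < 0, {f : L2 | (inner ℂ (fourierBasis (T := 1) n) f : ℂ) = 0} := by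
    ext f
    simp only [Set.mem_iInter, Set.mem_ofPred_eq]
    constructor
    · intro hf n hn
      rw [← HilbertBasis.repr_apply_apply, fourierBasis_repr]
      exact hf n hn
    · intro hf n hn
      rw [← fourierBasis_repr, HilbertBasis.repr_apply_apply]
      exact hf n hn
  rw [h]
  refine isClosed_iInter fun n => isClosed_iInter fun _ => ?_
  exact isClosed_eq (by fun_prop) continuous_const

/-- The product `b f ∈ L²` of an essentially bounded function `b` and `f ∈ L²`. -/
def mulBdd (b : L2) (hb : MemLp b ∞ m) (f : L2) : L2 :=
  ((Lp.memLp f).mul hb : MemLp ((b : Torus → ℂ) * (f : Torus → ℂ)) 2 m).toLp _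

/-- Inner functions, given by their boundary values: `u ∈ H²` with `|u| = 1` almost everywhere. -/
structure InnerFunction where
  /-- the boundary function -/
  toL2 : L2
  mem_H2 : toL2 ∈ H2
  unimodular : ∀ᵐ t ∂m, ‖toL2 t‖ = 1

theorem InnerFunction.bdd (u : InnerFunction) : MemLp u.toL2 ∞ m :=
  memLp_top_of_bound (Lp.aestronglyMeasurable u.toL2) 1 (u.unimodular.mono fun _ h => h.le)

/-- `u` is constant (almost everywhere). -/
def InnerFunction.IsConstant (u : InnerFunction) : Prop :=
  ∃ c : ℂ, u.toL2 = Lp.const 2 m c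

/-- The coordinate function `z` on the circle. -/
def z : L2 := fourierLp 2 1

theorem z_bdd : MemLp z ∞ m := by
  refine memLp_top_of_bound (Lp.aestronglyMeasurable z) 1 ?_
  filter_upwards [coeFn_fourierLp (T := 1) 2 1] with t ht
  rw [z, ht]
  rw [fourier_apply, one_smul]
  exact (Circle.norm_coe _).le

/-- The subspace `u H²` of `L²`. -/
def uH2 (u : InnerFunction) : Submodule ℂ L2 where
  carrier := {g | ∃ h ∈ H2, g = mulBdd u.toL2 u.bdd h}
  zero_mem' := by
    refine ⟨0, H2.zero_mem, ?_⟩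
    apply Lp.ext
    filter_upwards [MemLp.coeFn_toLp ((Lp.memLp (0 : L2)).mul u.bdd (r := 2)),
      Lp.coeFn_zero ℂ 2 m] with t h1 h2
    rw [mulBdd, h1, h2]
    simp
  add_mem' := by
    rintro _ _ ⟨h, hh, rfl⟩ ⟨k, hk, rfl⟩
    refine ⟨h + k, H2.add_mem hh hk, ?_⟩
    rw [mulBdd, mulBdd, ← MemLp.toLp_add, mulBdd, MemLp.toLp_eq_toLp_iff]
    filter_upwards [Lp.coeFn_add h k] with t ht
    rw [Pi.add_apply, Pi.mul_apply, Pi.mul_apply, Pi.mul_apply]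
    rw [show (h + k : L2) t = h t + k t from ht, mul_add]
  smul_mem' := by
    rintro c _ ⟨h, hh, rfl⟩
    refine ⟨c • h, H2.smul_mem c hh, ?_⟩
    rw [mulBdd, ← MemLp.toLp_const_smul, mulBdd, MemLp.toLp_eq_toLp_iff]
    filter_upwards [Lp.coeFn_smul c h] with t ht
    simp [ht, mul_left_comm]

/-- The model space `K_u = H² ⊖ u H²`. -/
def K (u : InnerFunction) : Submodule ℂ L2 := H2 ⊓ (uH2 u)ᗮ

instance instCompleteSpaceK (u : InnerFunction) : CompleteSpace (K u) :=
  (isClosed_H2.inter (Submodule.isClosed_orthogonal (uH2 u))).completeSpace_coe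

/-- The orthogonal projection `P_u` of `L²` onto the model space. -/
def P (u : InnerFunction) : L2 →L[ℂ] K u := (K u).orthogonalProjectionOnto

/-- The truncated Toeplitz operator `A_Φ f = P_u (Φ f)` with symbol `Φ ∈ L²`, defined on the
bounded functions `f` of the model space. -/
def truncatedToeplitz (u : InnerFunction) (Φ : L2) (f : K u) (hf : MemLp (f : L2) ∞ m) : K u :=
  P u (mulBdd (f : L2) hf Φ)

/-- `Φ` is a symbol of the bounded operator `A` on the model space: `A` is the bounded extension
of `A_Φ` to the whole model space. -/
def HasSymbol (u : InnerFunction) (A : K u →L[ℂ] K u) (Φ : L2) : Prop :=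
  ∀ (f : K u) (hf : MemLp (f : L2) ∞ m), A f = truncatedToeplitz u Φ f hf

/-- `A` is a bounded truncated Toeplitz operator on the model space. -/
def IsTTO (u : InnerFunction) (A : K u →L[ℂ] K u) : Prop :=
  ∃ Φ : L2, HasSymbol u A Φ

/-- The conjugation `C f = u · conj (z f)`. -/
def C (u : InnerFunction) (f : L2) : L2 :=
  mulBdd u.toL2 u.bdd (star (mulBdd z z_bdd f))

/-- The compressed shift `S_u f = P_u (z f)`. It is written for all `f ∈ L²` and used only on the
model space, which the conjugation `C` maps to itself. -/
def S (u : InnerFunction) (f : L2) : K u := P u (mulBdd z z_bdd f)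

/-- The bounded operator `A` is a truncated Toeplitz operator of type `α`, for `α` in the Riemann
sphere. For finite `α` it has a symbol `φ + α · conj (S_u C φ) + c` with `φ ∈ K_u` and a
constant `c`; for `α = ∞` it has an antiholomorphic symbol, the conjugate of a function of `H²`. -/
def IsOfType (u : InnerFunction) (A : K u →L[ℂ] K u) : OnePoint ℂ → Prop
  | none => ∃ ψ ∈ H2, HasSymbol u A (star ψ)
  | some α => ∃ (φ : K u) (c : ℂ),
      HasSymbol u A ((φ : L2) + α • star (S u (C u (φ : L2)) : L2) + Lp.const 2 m c)

end TTO

end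

/-!
A bounded operator `A` on `K_u` is a truncated Toeplitz operator exactly when its displacement
`A - S_u A S_u*` has the form `φ ⊗ k + k ⊗ χ`, where `k` is the reproducing kernel at the origin,
and then `φ + conj χ` is a symbol of `A`. Every such operator satisfies `A C = C A*`.
If `A` and `B` have displacement vectors `(φ₁, χ₁)` and `(φ₂, χ₂)`, then, modulo operators of the
form `x ⊗ k + k ⊗ y`, the displacement of `A B` is `φ₁ ⊗ χ₂ - S_u C χ₁ ⊗ S_u C φ₂`. Hence `A B` is
a truncated Toeplitz operator exactly when two rank-one operators agree modulo `k`. If neither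
vanishes, comparing their factors gives the common type `α`; if both vanish, one of the operators is
scalar or both are of type `0` or `∞`. Products of operators of the same type are again of that type
because complex symmetric operators with a complex symmetric product commute.
-/

open scoped InnerProductSpace InnerProduct ComplexConjugate
open Filter Topology InnerProductSpace

noncomputable section

namespace TTO

theorem rankOne_eq_rankOne_cases {𝕜 E F : Type*} [RCLike 𝕜] [NormedAddCommGroup E]
    [InnerProductSpace 𝕜 E] [NormedAddCommGroup F] [InnerProductSpace 𝕜 F] {x x' : E} {y y' : F}
    (h : rankOne 𝕜 x y = rankOne 𝕜 x' y') :
    ((x = 0 ∨ y = 0) ∧ (x' = 0 ∨ y' = 0)) ∨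
      ∃ l : 𝕜, l ≠ 0 ∧ x = l • x' ∧ y' = conj l • y := by
  by_cases hxy : x = 0 ∨ y = 0
  · exact .inl ⟨hxy, rankOne_eq_zero.1 (h ▸ rankOne_eq_zero.2 hxy)⟩
  right
  push Not at hxy
  obtain ⟨l, -, hl, -, rfl, -⟩ := exists_of_rankOne_eq_rankOne hxy.1 hxy.2 h
  have hx' : x' ≠ 0 := right_ne_zero_of_smul hxy.1
  have hsub : rankOne 𝕜 x' (y' - conj l • y) = 0 := by
    ext v
    have hv : ⟪y, v⟫_𝕜 • l • x' = ⟪y', v⟫_𝕜 • x' := congrArg (fun T => T v) h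
    simp only [rankOne_apply, inner_sub_left, inner_smul_left, RCLike.conj_conj, zero_apply]
    linear_combination (norm := module) -hv
  exact ⟨l, hl, rfl, sub_eq_zero.1 ((rankOne_eq_zero.1 hsub).resolve_left hx')⟩

/-- The abstract form of a compressed shift: a contraction `S` with one-dimensional defect
`1 - S S* = k ⊗ k`, intertwined with its adjoint by a conjugation `C`, and such that the powers of
`S*` tend strongly to `0`. -/
structure ConjugatedShift (𝕜 H : Type*) [RCLike 𝕜] [NormedAddCommGroup H] [InnerProductSpace 𝕜 H]
    [CompleteSpace H] where
  /-- the contraction -/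
  S : H →L[𝕜] H
  /-- the conjugation -/
  C : H →ₗ⋆[𝕜] H
  /-- the defect vector -/
  k : H
  C_C : ∀ x, C (C x) = x
  inner_C_C : ∀ x y, ⟪C x, C y⟫_𝕜 = ⟪y, x⟫_𝕜
  S_C : ∀ x, S (C x) = C ((S†) x)
  S_adjoint : ∀ x, S ((S†) x) = x - ⟪k, x⟫_𝕜 • k
  tendsto_adjoint_iterate : ∀ x, Tendsto (fun n => (S†)^[n] x) atTop (𝓝 0)

namespace ConjugatedShift

variable {𝕜 H : Type*} [RCLike 𝕜] [NormedAddCommGroup H] [InnerProductSpace 𝕜 H] [CompleteSpace H]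
  (M : ConjugatedShift 𝕜 H)

theorem inner_C_left (x y : H) : ⟪M.C x, y⟫_𝕜 = ⟪M.C y, x⟫_𝕜 := by
  rw [← M.inner_C_C y (M.C x), M.C_C]

theorem inner_C_right (x y : H) : ⟪x, M.C y⟫_𝕜 = ⟪y, M.C x⟫_𝕜 := by
  rw [← inner_conj_symm, M.inner_C_left, inner_conj_symm]

theorem continuous_C : Continuous M.C := by
  refine (AddMonoidHomClass.isometry_of_norm M.C fun x => ?_).continuous
  rw [@norm_eq_sqrt_re_inner 𝕜, M.inner_C_C, ← norm_eq_sqrt_re_inner]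

theorem adjoint_C (x : H) : (M.S†) (M.C x) = M.C (M.S x) := by
  rw [← M.C_C ((M.S†) (M.C x)), ← M.S_C, M.C_C]

theorem adjoint_S (x : H) : (M.S†) (M.S x) = x - ⟪M.C M.k, x⟫_𝕜 • M.C M.k := by
  have h := M.S_adjoint (M.C x)
  rw [M.adjoint_C, M.S_C] at h
  rw [← M.C_C ((M.S†) (M.S x)), h, map_sub, M.C_C, map_smulₛₗ, inner_conj_symm,
    M.inner_C_left]

theorem eq_zero_of_inner_k_iterate {x : H} (h : ∀ n, ⟪M.k, (M.S†)^[n] x⟫_𝕜 = 0) : x = 0 := by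
  have norm_iterate (n : ℕ) : ‖(M.S†)^[n] x‖ = ‖x‖ := by
    induction n with
    | zero => rfl
    | succ n ih =>
      rw [← ih, Function.iterate_succ_apply', @norm_eq_sqrt_re_inner 𝕜,
        ContinuousLinearMap.adjoint_inner_left, M.S_adjoint, h, zero_smul, sub_zero,
        ← norm_eq_sqrt_re_inner]
  have hlim := (M.tendsto_adjoint_iterate x).norm
  simp only [norm_iterate, norm_zero] at hlim
  exact norm_eq_zero.1 (tendsto_const_nhds_iff.1 hlim)

theorem dense_of_invariant {D : Submodule 𝕜 H} (hk : M.k ∈ D) (hS : ∀ x ∈ D, M.S x ∈ D) :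
    Dense (D : Set H) := by
  rw [Submodule.dense_iff_topologicalClosure_eq_top, Submodule.topologicalClosure_eq_top_iff,
    Submodule.eq_bot_iff]
  intro x hx
  have inner_iterate (n : ℕ) : ∀ y ∈ D, ⟪y, (M.S†)^[n] x⟫_𝕜 = 0 := by
    induction n with
    | zero => exact fun y hy => hx y hy
    | succ n ih =>
      intro y hy
      rw [Function.iterate_succ_apply', ContinuousLinearMap.adjoint_inner_right, ih _ (hS y hy)]
  exact M.eq_zero_of_inner_k_iterate fun n => inner_iterate n M.k hk

theorem k_ne_zero [Nontrivial H] : M.k ≠ 0 := by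
  intro hk
  obtain ⟨x, hx⟩ := exists_ne (0 : H)
  exact hx (M.eq_zero_of_inner_k_iterate fun n => by rw [hk, inner_zero_left])

theorem inner_k_k_ne_zero [Nontrivial H] : ⟪M.k, M.k⟫_𝕜 ≠ 0 :=
  inner_self_ne_zero.2 M.k_ne_zero

/-! ### The conjugate-linear map `S C` -/

/-- The conjugate-linear map `S C`, which exchanges the two vectors of a displacement. -/
def SC : H →ₗ⋆[𝕜] H := (M.S : H →ₗ[𝕜] H).comp M.C

/-- The eigenvalue of `S C` at the defect vector; on the model space `K_u` it is `-u(0)`. -/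
def μ : 𝕜 := ⟪M.k, M.SC M.k⟫_𝕜 / ⟪M.k, M.k⟫_𝕜

theorem SC_apply (x : H) : M.SC x = M.S (M.C x) := rfl

theorem C_adjoint (x : H) : M.C ((M.S†) x) = M.SC x := (M.S_C x).symm

theorem C_SC (x : H) : M.C (M.SC x) = (M.S†) x := by rw [← M.C_adjoint, M.C_C]

theorem SC_SC (x : H) : M.SC (M.SC x) = x - ⟪M.k, x⟫_𝕜 • M.k := by
  rw [M.SC_apply, M.C_SC, M.S_adjoint]

theorem inner_SC_left (x y : H) : ⟪M.SC x, y⟫_𝕜 = ⟪M.SC y, x⟫_𝕜 := by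
  rw [M.SC_apply, ← ContinuousLinearMap.adjoint_inner_right, M.inner_C_left, M.C_adjoint]

theorem inner_SC_right (x y : H) : ⟪x, M.SC y⟫_𝕜 = ⟪y, M.SC x⟫_𝕜 := by
  rw [← inner_conj_symm, M.inner_SC_left, inner_conj_symm]

section
variable [Nontrivial H]

-- Comparing `(S S*) S` with `S (S* S)` gives `k ⊗ S* k = S C k ⊗ C k`.
theorem SC_k : M.SC M.k = M.μ • M.k := by
  have h : ⟪M.k, M.k⟫_𝕜 • M.SC M.k = ⟪M.k, M.SC M.k⟫_𝕜 • M.k := by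
    have h := M.S_adjoint (M.SC M.k)
    rw [M.SC_apply, M.adjoint_S, map_sub, map_smul, M.inner_C_C] at h
    exact sub_right_injective h
  refine smul_right_injective H M.inner_k_k_ne_zero ?_
  simp only [h, μ, smul_smul, mul_div_cancel₀ _ M.inner_k_k_ne_zero]

theorem adjoint_k : (M.S†) M.k = conj M.μ • M.C M.k := by
  rw [← M.C_SC, M.SC_k, map_smulₛₗ]

theorem inner_k_k : ⟪M.k, M.k⟫_𝕜 = 1 - M.μ * conj M.μ := by
  have h := M.SC_SC M.k
  rw [M.SC_k, map_smulₛₗ, M.SC_k, smul_smul] at h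
  refine smul_left_injective 𝕜 M.k_ne_zero ?_
  linear_combination (norm := module) h

end

/-! ### Complex symmetric operators and operators with a displacement -/

/-- `A` is complex symmetric with respect to the conjugation `C`: `A C = C A*`. -/
def IsComplexSymmetric (A : H →L[𝕜] H) : Prop := ∀ x, A (M.C x) = M.C ((A†) x)

/-- The displacement `A - S A S*` of `A` is the operator `φ ⊗ k + k ⊗ χ` of rank at most two. For
compressed shifts of model spaces, this is Sarason's characterisation of truncated Toeplitz
operators. -/
def HasDisplacement (A : H →L[𝕜] H) (φ χ : H) : Prop :=
  A - M.S ∘L A ∘L M.S† = rankOne 𝕜 φ M.k + rankOne 𝕜 M.k χ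

variable {M} {A B : H →L[𝕜] H} {φ χ φ₁ χ₁ φ₂ χ₂ : H}

theorem IsComplexSymmetric.adjoint (hA : M.IsComplexSymmetric A) : M.IsComplexSymmetric (A†) := by
  intro x
  rw [ContinuousLinearMap.adjoint_adjoint, ← M.C_C ((A†) (M.C x)), ← hA, M.C_C]

theorem IsComplexSymmetric.commute (hA : M.IsComplexSymmetric A) (hB : M.IsComplexSymmetric B)
    (hAB : M.IsComplexSymmetric (A ∘L B)) : A ∘L B = B ∘L A := by
  ext x
  have h := hAB (M.C x)
  rw [M.C_C, ContinuousLinearMap.adjoint_comp] at h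
  rw [h, ContinuousLinearMap.comp_apply, ← hB, ← hA, M.C_C]
  rfl

theorem isComplexSymmetric_of_dense {D : Set H} (hD : Dense D)
    (h : ∀ x ∈ D, ∀ y ∈ D, ⟪y, A (M.C x)⟫_𝕜 = ⟪x, A (M.C y)⟫_𝕜) : M.IsComplexSymmetric A := by
  refine congrFun (Continuous.ext_on hD (A.continuous.comp M.continuous_C)
    (M.continuous_C.comp (A†).continuous) fun x hx =>
      hD.eq_of_inner_right 𝕜 fun y hy => (h x hx y hy).trans ?_)
  rw [← ContinuousLinearMap.adjoint_inner_left, M.inner_C_right]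

theorem hasDisplacement_iff : M.HasDisplacement A φ χ ↔
    ∀ x, A x - M.S (A ((M.S†) x)) = ⟪M.k, x⟫_𝕜 • φ + ⟪χ, x⟫_𝕜 • M.k :=
  ContinuousLinearMap.ext_iff

theorem hasDisplacement_of_dense {D : Set H} (hD : Dense D)
    (h : ∀ x ∈ D, A x - M.S (A ((M.S†) x)) = ⟪M.k, x⟫_𝕜 • φ + ⟪χ, x⟫_𝕜 • M.k) :
    M.HasDisplacement A φ χ :=
  hasDisplacement_iff.2 (congrFun (Continuous.ext_on hD (by fun_prop) (by fun_prop) h))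

theorem HasDisplacement.adjoint (hA : M.HasDisplacement A φ χ) : M.HasDisplacement (A†) χ φ := by
  have h := congrArg ContinuousLinearMap.adjoint hA
  simp only [map_sub, map_add, ContinuousLinearMap.adjoint_comp, adjoint_rankOne,
    ContinuousLinearMap.adjoint_adjoint, ContinuousLinearMap.comp_assoc] at h
  rw [HasDisplacement, h, add_comm]

theorem hasDisplacement_sub_smul_id {c : 𝕜} :
    M.HasDisplacement (A - c • ContinuousLinearMap.id 𝕜 H) φ χ ↔
      M.HasDisplacement A φ (χ + conj c • M.k) := by
  simp only [hasDisplacement_iff]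
  refine forall_congr' fun x => ?_
  have h := M.S_adjoint x
  simp only [sub_apply, smul_apply, ContinuousLinearMap.id_apply, map_sub, map_smul, h,
    inner_add_left, inner_smul_left, RCLike.conj_conj]
  constructor <;> intro h <;> linear_combination (norm := module) h

theorem HasDisplacement.gauge (hA : M.HasDisplacement A φ χ) (c : 𝕜) :
    M.HasDisplacement A (φ - c • M.k) (χ + conj c • M.k) := by
  rw [hasDisplacement_iff] at hA ⊢
  intro x
  rw [hA x]
  simp only [inner_add_left, inner_smul_left, RCLike.conj_conj]
  module

theorem HasDisplacement.exists_eq_add_smul [Nontrivial H] {φ' χ' : H}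
    (h : M.HasDisplacement A φ χ) (h' : M.HasDisplacement A φ' χ') :
    ∃ c : 𝕜, φ' = φ + c • M.k := by
  have h₁ := (hasDisplacement_iff.1 h M.k).symm.trans (hasDisplacement_iff.1 h' M.k)
  refine ⟨(⟪M.k, M.k⟫_𝕜)⁻¹ * (⟪χ, M.k⟫_𝕜 - ⟪χ', M.k⟫_𝕜), ?_⟩
  refine smul_right_injective H M.inner_k_k_ne_zero ?_
  simp only [smul_add, smul_smul, mul_inv_cancel_left₀ M.inner_k_k_ne_zero]
  linear_combination (norm := module) -h₁

theorem HasDisplacement.sub_adjoint_comp (hA : M.HasDisplacement A φ χ)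
    (hC : M.IsComplexSymmetric A) (x : H) :
    A x - (M.S†) (A (M.S x)) = ⟪M.C M.k, x⟫_𝕜 • M.C χ + ⟪M.C φ, x⟫_𝕜 • M.C M.k := by
  have h := congrArg M.C (hasDisplacement_iff.1 hA.adjoint (M.C x))
  simp only [map_sub, map_add, map_smulₛₗ, inner_conj_symm] at h
  rwa [← hC, M.C_C, M.adjoint_C, ← M.adjoint_C, ← hC, M.C_C, ← M.inner_C_left M.k,
    ← M.inner_C_left φ] at h

section
variable [Nontrivial H]

theorem HasDisplacement.inner_k_apply_k (hA : M.HasDisplacement A φ χ)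
    (hC : M.IsComplexSymmetric A) : ⟪M.k, A M.k⟫_𝕜 = ⟪M.k, φ⟫_𝕜 + ⟪χ, M.k⟫_𝕜 := by
  have hSAC : ⟪M.k, M.S (A (M.C M.k))⟫_𝕜 = M.μ * ⟪M.k, A M.k⟫_𝕜 := by
    rw [← ContinuousLinearMap.adjoint_inner_left, M.adjoint_k, inner_smul_left, RCLike.conj_conj,
      hC, M.inner_C_C, ContinuousLinearMap.adjoint_inner_left]
  have h := congrArg (fun v => ⟪M.k, v⟫_𝕜) (hasDisplacement_iff.1 hA M.k)
  simp only [M.adjoint_k, map_smul, inner_sub_right, inner_add_right, inner_smul_right, hSAC] at h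
  refine mul_left_cancel₀ M.inner_k_k_ne_zero ?_
  linear_combination h + ⟪M.k, A M.k⟫_𝕜 * M.inner_k_k

-- Evaluating both displacement identities on the defect vectors gives a linear system for
-- `A k` and `S A C k` with determinant `1 - |μ|² = ‖k‖²`.
theorem HasDisplacement.apply_k (hA : M.HasDisplacement A φ χ) (hC : M.IsComplexSymmetric A) :
    A M.k = φ + conj M.μ • M.SC χ + ⟪χ, M.k⟫_𝕜 • M.k ∧
      M.S (A (M.C M.k)) = M.SC χ + M.μ • φ := by
  have h₁ := hasDisplacement_iff.1 hA M.k
  have h₂ := congrArg M.S (hA.sub_adjoint_comp hC (M.C M.k))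
  rw [M.adjoint_k] at h₁
  rw [M.inner_C_C, M.inner_C_C] at h₂
  simp only [map_sub, map_add, map_smul, M.S_adjoint, ← M.SC_apply, M.SC_k, M.inner_k_k,
    hA.inner_k_apply_k hC] at h₁ h₂
  have hκ : 1 - M.μ * conj M.μ ≠ 0 := M.inner_k_k ▸ M.inner_k_k_ne_zero
  constructor <;> refine smul_right_injective H hκ ?_
  · linear_combination (norm := module) h₁ + conj M.μ • h₂
  · linear_combination (norm := module) h₂ + M.μ • h₁

theorem HasDisplacement.adjoint_apply_SC (hB : M.HasDisplacement B φ χ)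
    (hC : M.IsComplexSymmetric B) (x : H) :
    (B†) (M.SC x) = M.SC (B x) - ⟪x, M.k⟫_𝕜 • M.SC φ + ⟪φ, M.SC x⟫_𝕜 • M.k := by
  have hinner : ⟪B ((M.S†) x), M.C M.k⟫_𝕜 = ⟪φ, M.SC x⟫_𝕜 + M.μ * ⟪x, χ⟫_𝕜 := by
    rw [← ContinuousLinearMap.adjoint_inner_right, ContinuousLinearMap.adjoint_inner_left,
      (hB.adjoint.apply_k hC.adjoint).2, inner_add_right, inner_smul_right, M.inner_SC_right]
  have h := congrArg (fun v => M.C ((M.S†) v)) (hasDisplacement_iff.1 hB x)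
  simp only [map_sub, map_add, map_smul, map_smulₛₗ, M.adjoint_S, inner_conj_symm, M.C_C,
    M.C_adjoint, M.SC_k, hinner] at h
  have hcomm : (B†) (M.SC x) = M.C (B ((M.S†) x)) := by
    rw [← M.C_adjoint, hC.adjoint, ContinuousLinearMap.adjoint_adjoint]
  rw [hcomm]
  linear_combination (norm := module) -h

theorem HasDisplacement.comp (hA : M.HasDisplacement A φ₁ χ₁) (hB : M.HasDisplacement B φ₂ χ₂)
    (hCA : M.IsComplexSymmetric A) (hCB : M.IsComplexSymmetric B) :
    A ∘L B - M.S ∘L (A ∘L B) ∘L M.S† = rankOne 𝕜 (A φ₂) M.k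
      + rankOne 𝕜 M.k ((B†) χ₁ - ⟪φ₂, χ₁⟫_𝕜 • M.k)
      + rankOne 𝕜 φ₁ χ₂ - rankOne 𝕜 (M.SC χ₁) (M.SC φ₂) := by
  ext x
  obtain ⟨hAk, hSAC⟩ := hA.apply_k hCA
  obtain ⟨hBk, hSBC⟩ := hB.adjoint.apply_k hCB.adjoint
  have hSBS : M.S (B ((M.S†) x)) = B x - ⟪M.k, x⟫_𝕜 • φ₂ - ⟪χ₂, x⟫_𝕜 • M.k := by
    rw [sub_sub, ← hasDisplacement_iff.1 hB x, sub_sub_cancel]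
  have hCk : ⟪M.C M.k, B ((M.S†) x)⟫_𝕜 = ⟪M.SC φ₂ + M.μ • χ₂, x⟫_𝕜 := by
    rw [← hSBC, ← ContinuousLinearMap.adjoint_inner_right, ContinuousLinearMap.adjoint_inner_left]
  have hk : ⟪M.k, B x⟫_𝕜 = ⟪χ₂ + conj M.μ • M.SC φ₂ + ⟪φ₂, M.k⟫_𝕜 • M.k, x⟫_𝕜 := by
    rw [← hBk, ContinuousLinearMap.adjoint_inner_left]
  have h := hasDisplacement_iff.1 hA (M.S (B ((M.S†) x)))
  rw [M.adjoint_S] at h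
  simp only [map_sub, map_smul, hCk, hSAC] at h
  simp only [hSBS, map_sub, map_smul, hAk, hk, inner_sub_right, inner_smul_right,
    M.inner_k_k] at h
  simp only [inner_add_left, inner_smul_left, RCLike.conj_conj, inner_conj_symm] at h
  simp only [sub_apply, add_apply, ContinuousLinearMap.comp_apply, rankOne_apply, inner_sub_left,
    inner_smul_left, inner_conj_symm, ContinuousLinearMap.adjoint_inner_left]
  linear_combination (norm := module) h

end

/-! ### Recovering an operator from its displacement -/

theorem HasDisplacement.inner_apply_eq_add_sum (hA : M.HasDisplacement A φ χ) (x y : H) (n : ℕ) :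
    ⟪y, A x⟫_𝕜 = ⟪(M.S†)^[n] y, A ((M.S†)^[n] x)⟫_𝕜 +
      ∑ j ∈ Finset.range n, (⟪M.k, (M.S†)^[j] x⟫_𝕜 * ⟪(M.S†)^[j] y, φ⟫_𝕜 +
        ⟪χ, (M.S†)^[j] x⟫_𝕜 * ⟪(M.S†)^[j] y, M.k⟫_𝕜) := by
  induction n with
  | zero => simp
  | succ n ih =>
    have h := congrArg (fun v => ⟪(M.S†)^[n] y, v⟫_𝕜) (hasDisplacement_iff.1 hA ((M.S†)^[n] x))
    simp only [inner_sub_right, inner_add_right, inner_smul_right] at h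
    rw [← ContinuousLinearMap.adjoint_inner_left M.S] at h
    rw [ih, Finset.sum_range_succ, Function.iterate_succ_apply', Function.iterate_succ_apply']
    linear_combination h

theorem HasDisplacement.tendsto_sum (hA : M.HasDisplacement A φ χ) (x y : H) :
    Tendsto (fun n => ∑ j ∈ Finset.range n, (⟪M.k, (M.S†)^[j] x⟫_𝕜 * ⟪(M.S†)^[j] y, φ⟫_𝕜 +
      ⟪χ, (M.S†)^[j] x⟫_𝕜 * ⟪(M.S†)^[j] y, M.k⟫_𝕜)) atTop (𝓝 ⟪y, A x⟫_𝕜) := by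
  have hrem : Tendsto (fun n => ⟪(M.S†)^[n] y, A ((M.S†)^[n] x)⟫_𝕜) atTop (𝓝 0) := by
    simpa using (M.tendsto_adjoint_iterate y).inner
      ((A.continuous.tendsto 0).comp (M.tendsto_adjoint_iterate x)) (𝕜 := 𝕜)
  have h := (tendsto_const_nhds (x := ⟪y, A x⟫_𝕜)).sub hrem
  rw [sub_zero] at h
  exact h.congr fun n => sub_eq_of_eq_add' (hA.inner_apply_eq_add_sum x y n)

theorem HasDisplacement.unique (hA : M.HasDisplacement A φ χ) (hB : M.HasDisplacement B φ χ) :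
    A = B :=
  ContinuousLinearMap.ext fun x => ext_inner_left 𝕜 fun y =>
    tendsto_nhds_unique (hA.tendsto_sum x y) (hB.tendsto_sum x y)

theorem HasDisplacement.eq_smul_id {c : 𝕜} (hA : M.HasDisplacement A 0 (c • M.k)) :
    A = conj c • ContinuousLinearMap.id 𝕜 H := by
  refine sub_eq_zero.1 (HasDisplacement.unique (M := M) (φ := 0) (χ := 0) ?_ ?_)
  · rwa [hasDisplacement_sub_smul_id, RCLike.conj_conj, zero_add]
  · simp [HasDisplacement]

/-! ### Types -/

/-- The operator `A` is of type `α` in the sphere `𝕜 ∪ {∞}`: up to multiples of `k` the vectors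
`φ` and `χ` of its displacement satisfy `χ = conj α • S C φ` for finite `α`, and `φ = 0` for
`α = ∞`. -/
def IsOfType (M : ConjugatedShift 𝕜 H) (A : H →L[𝕜] H) : OnePoint 𝕜 → Prop
  | none => ∃ χ, M.HasDisplacement A 0 χ
  | some α => ∃ (φ : H) (c : 𝕜), M.HasDisplacement A φ (conj α • M.SC φ + conj c • M.k)

variable (M) in
/-- The orthogonal projection onto the complement of the defect vector: two vectors have the same
image if and only if they agree modulo `k`. -/
def defectProj : H →L[𝕜] H := (𝕜 ∙ M.k)ᗮ.starProjection

theorem defectProj_eq_zero_iff : M.defectProj φ = 0 ↔ ∃ c : 𝕜, φ = c • M.k := by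
  rw [defectProj, Submodule.starProjection_apply_eq_zero_iff, Submodule.orthogonal_orthogonal,
    Submodule.mem_span_singleton]
  simp only [eq_comm]

theorem defectProj_eq_iff : M.defectProj φ = M.defectProj χ ↔ ∃ c : 𝕜, φ = χ + c • M.k := by
  simp only [← sub_eq_zero (a := M.defectProj φ), ← map_sub, defectProj_eq_zero_iff,
    sub_eq_iff_eq_add']

theorem defectProj_SC_SC : M.defectProj (M.SC (M.SC φ)) = M.defectProj φ :=
  defectProj_eq_iff.2 ⟨-⟪M.k, φ⟫_𝕜, by rw [M.SC_SC, neg_smul, sub_eq_add_neg]⟩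

theorem HasDisplacement.isOfType_infty (hA : M.HasDisplacement A φ χ) (h : M.defectProj φ = 0) :
    M.IsOfType A OnePoint.infty := by
  obtain ⟨c, rfl⟩ := defectProj_eq_zero_iff.1 h
  have h := hA.gauge c
  rw [sub_self] at h
  exact ⟨_, h⟩

theorem HasDisplacement.isOfType_coe {α : 𝕜} (hA : M.HasDisplacement A φ χ)
    (h : M.defectProj χ = M.defectProj (conj α • M.SC φ)) : M.IsOfType A α := by
  obtain ⟨c, rfl⟩ := defectProj_eq_iff.1 h
  exact ⟨φ, conj c, by rwa [RCLike.conj_conj]⟩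

theorem HasDisplacement.exists_eq_smul_id (hA : M.HasDisplacement A φ χ)
    (hφ : M.defectProj φ = 0) (hχ : M.defectProj χ = 0) :
    ∃ c : 𝕜, A = c • ContinuousLinearMap.id 𝕜 H := by
  obtain ⟨c, rfl⟩ := defectProj_eq_zero_iff.1 hφ
  obtain ⟨d, rfl⟩ := defectProj_eq_zero_iff.1 hχ
  have h := hA.gauge c
  rw [sub_self, ← add_smul] at h
  exact ⟨_, h.eq_smul_id⟩

variable [Nontrivial H]

theorem HasDisplacement.comp_left_zero (hA : M.HasDisplacement A 0 χ₁)
    (hB : M.HasDisplacement B 0 χ₂) (hCA : M.IsComplexSymmetric A)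
    (hCB : M.IsComplexSymmetric B) : M.HasDisplacement (A ∘L B) 0 ((B†) χ₁) := by
  simpa [HasDisplacement] using hA.comp hB hCA hCB

theorem HasDisplacement.comp_of_type {α c₁ c₂ : 𝕜}
    (hA : M.HasDisplacement A φ₁ (conj α • M.SC φ₁ + conj c₁ • M.k))
    (hB : M.HasDisplacement B φ₂ (conj α • M.SC φ₂ + conj c₂ • M.k))
    (hCA : M.IsComplexSymmetric A) (hCB : M.IsComplexSymmetric B) :
    M.HasDisplacement (A ∘L B) (A φ₂ + c₂ • φ₁)
      (conj α • M.SC (B φ₁ + c₁ • φ₂) + conj (c₁ * c₂) • M.k) := by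
  have hBk := (hB.adjoint.apply_k hCB.adjoint).1
  have hBχ : (B†) (conj α • M.SC φ₁ + conj c₁ • M.k) =
      conj α • M.SC (B φ₁ + c₁ • φ₂) + conj (c₁ * c₂) • M.k
        + ⟪φ₂, conj α • M.SC φ₁ + conj c₁ • M.k⟫_𝕜 • M.k
        - (conj α * ⟪φ₁, M.k⟫_𝕜 - conj c₁ * conj M.μ) • M.SC φ₂ := by
    simp only [map_add, map_smul, map_smulₛₗ, map_mul, hB.adjoint_apply_SC hCB, hBk,
      inner_add_right, inner_smul_right]
    module
  have hSCχ : M.SC (conj α • M.SC φ₁ + conj c₁ • M.k) =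
      α • φ₁ - (α * ⟪M.k, φ₁⟫_𝕜 - c₁ * M.μ) • M.k := by
    simp only [map_add, map_smulₛₗ, M.SC_SC, M.SC_k, RCLike.conj_conj]
    module
  rw [HasDisplacement, hA.comp hB hCA hCB, hBχ, hSCχ]
  ext x
  simp only [sub_apply, add_apply, rankOne_apply, inner_add_left, inner_smul_left, map_sub,
    map_mul, RCLike.conj_conj, inner_conj_symm]
  module

theorem IsOfType.exists_hasDisplacement_comp {α : OnePoint 𝕜} (hA : M.IsOfType A α)
    (hB : M.IsOfType B α) (hCA : M.IsComplexSymmetric A) (hCB : M.IsComplexSymmetric B) :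
    ∃ φ χ, M.HasDisplacement (A ∘L B) φ χ := by
  induction α using OnePoint.rec with
  | infty =>
    obtain ⟨χ₁, hA⟩ := hA
    obtain ⟨χ₂, hB⟩ := hB
    exact ⟨_, _, hA.comp_left_zero hB hCA hCB⟩
  | coe α =>
    obtain ⟨φ₁, c₁, hA⟩ := hA
    obtain ⟨φ₂, c₂, hB⟩ := hB
    exact ⟨_, _, hA.comp_of_type hB hCA hCB⟩

-- The two expressions for the displacement of `A B = B A` show that the vectors
-- `A φ₂ + c₂ φ₁` and `B φ₁ + c₁ φ₂` agree modulo `k`.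
theorem IsOfType.comp {α : OnePoint 𝕜} (hA : M.IsOfType A α) (hB : M.IsOfType B α)
    (hCA : M.IsComplexSymmetric A) (hCB : M.IsComplexSymmetric B) (hAB : A ∘L B = B ∘L A) :
    M.IsOfType (A ∘L B) α := by
  induction α using OnePoint.rec with
  | infty =>
    obtain ⟨χ₁, hA⟩ := hA
    obtain ⟨χ₂, hB⟩ := hB
    exact ⟨_, hA.comp_left_zero hB hCA hCB⟩
  | coe α =>
    obtain ⟨φ₁, c₁, hA⟩ := hA
    obtain ⟨φ₂, c₂, hB⟩ := hB
    have hcomp := hA.comp_of_type hB hCA hCB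
    obtain ⟨d, hd⟩ := hcomp.exists_eq_add_smul (hAB ▸ hB.comp_of_type hA hCB hCA)
    refine ⟨A φ₂ + c₂ • φ₁, α * d * conj M.μ + c₁ * c₂, ?_⟩
    convert hcomp using 1
    rw [hd]
    simp only [map_add, map_smulₛₗ, map_mul, M.SC_k, RCLike.conj_conj]
    module

/-! ### The types of the factors of a product with a displacement -/

theorem defectProj_SC_congr (h : M.defectProj φ = M.defectProj χ) :
    M.defectProj (M.SC φ) = M.defectProj (M.SC χ) := by
  obtain ⟨c, rfl⟩ := defectProj_eq_iff.1 h
  exact defectProj_eq_iff.2 ⟨conj c * M.μ, by rw [map_add, map_smulₛₗ, M.SC_k, smul_smul]⟩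

theorem defectProj_SC_eq_zero_iff : M.defectProj (M.SC φ) = 0 ↔ M.defectProj φ = 0 := by
  rw [← map_zero M.defectProj]
  refine ⟨fun h => ?_, fun h => ?_⟩
  · rw [← defectProj_SC_SC, defectProj_SC_congr h, map_zero]
  · rw [defectProj_SC_congr h, map_zero]

theorem HasDisplacement.rankOne_defectProj_eq (hA : M.HasDisplacement A φ₁ χ₁)
    (hB : M.HasDisplacement B φ₂ χ₂) (hAB : M.HasDisplacement (A ∘L B) φ χ)
    (hCA : M.IsComplexSymmetric A) (hCB : M.IsComplexSymmetric B) :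
    rankOne 𝕜 (M.defectProj φ₁) (M.defectProj χ₂) =
      rankOne 𝕜 (M.defectProj (M.SC χ₁)) (M.defectProj (M.SC φ₂)) := by
  have hk : M.defectProj M.k = 0 := defectProj_eq_zero_iff.2 ⟨1, (one_smul 𝕜 _).symm⟩
  have hself : M.defectProj† = M.defectProj :=
    isSelfAdjoint_starProjection _
  have h := congrArg (fun T => M.defectProj ∘L T ∘L M.defectProj)
    ((hA.comp hB hCA hCB).symm.trans hAB)
  simp only [ContinuousLinearMap.add_comp, ContinuousLinearMap.sub_comp,
    ContinuousLinearMap.comp_add, ContinuousLinearMap.comp_sub, rankOne_comp, comp_rankOne, hself,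
    hk, map_zero, zero_apply, zero_add] at h
  exact sub_eq_zero.1 h

theorem HasDisplacement.isOfType_of_comp (hA : M.HasDisplacement A φ₁ χ₁)
    (hB : M.HasDisplacement B φ₂ χ₂) (hAB : M.HasDisplacement (A ∘L B) φ χ)
    (hCA : M.IsComplexSymmetric A) (hCB : M.IsComplexSymmetric B) :
    ((∃ c : 𝕜, A = c • ContinuousLinearMap.id 𝕜 H) ∨
      ∃ c : 𝕜, B = c • ContinuousLinearMap.id 𝕜 H) ∨
    ∃ α : OnePoint 𝕜, M.IsOfType A α ∧ M.IsOfType B α := by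
  rcases rankOne_eq_rankOne_cases (hA.rankOne_defectProj_eq hB hAB hCA hCB) with
    ⟨hφ₁ | hχ₂, hχ₁ | hφ₂⟩ | ⟨l, hl, hφ₁, hφ₂⟩
  · exact .inl (.inl (hA.exists_eq_smul_id hφ₁ (defectProj_SC_eq_zero_iff.1 hχ₁)))
  · exact .inr ⟨.infty, hA.isOfType_infty hφ₁,
      hB.isOfType_infty (defectProj_SC_eq_zero_iff.1 hφ₂)⟩
  · refine .inr ⟨(0 : 𝕜), hA.isOfType_coe ?_, hB.isOfType_coe ?_⟩
    · rw [map_zero, zero_smul, map_zero, defectProj_SC_eq_zero_iff.1 hχ₁]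
    · rw [map_zero, zero_smul, map_zero, hχ₂]
  · exact .inl (.inr (hB.exists_eq_smul_id (defectProj_SC_eq_zero_iff.1 hφ₂) hχ₂))
  · have hl' : conj l ≠ 0 := (map_ne_zero _).2 hl
    refine .inr ⟨(l⁻¹ : 𝕜), hA.isOfType_coe ?_, hB.isOfType_coe ?_⟩
    · rw [← map_smul] at hφ₁
      rw [map_smul, defectProj_SC_congr hφ₁, map_smulₛₗ, map_smul, defectProj_SC_SC, map_inv₀,
        inv_smul_smul₀ hl']
    · rw [map_smul, hφ₂, map_inv₀, inv_smul_smul₀ hl']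

end ConjugatedShift

/-! ### Conjugation and inner products in `L²` -/

section
variable {α 𝕜 : Type*} [MeasurableSpace α] {ν : Measure α} [RCLike 𝕜]

theorem coeFn_star_eq_conj {p : ℝ≥0∞} (f : Lp 𝕜 p ν) : ∀ᵐ t ∂ν, (star f) t = conj (f t) :=
  Lp.coeFn_star f

theorem star_add_Lp {p : ℝ≥0∞} (f g : Lp 𝕜 p ν) : star (f + g) = star f + star g := by
  apply Lp.ext
  filter_upwards [coeFn_star_eq_conj (f + g), Lp.coeFn_add f g, Lp.coeFn_add (star f) (star g),
    coeFn_star_eq_conj f, coeFn_star_eq_conj g] with t hstar hadd hadd' hf hg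
  rw [hstar, hadd, hadd', Pi.add_apply, Pi.add_apply, hf, hg, map_add]

theorem star_smul_Lp {p : ℝ≥0∞} (c : 𝕜) (f : Lp 𝕜 p ν) : star (c • f) = conj c • star f := by
  apply Lp.ext
  filter_upwards [coeFn_star_eq_conj (c • f), Lp.coeFn_smul c f, Lp.coeFn_smul (conj c) (star f),
    coeFn_star_eq_conj f] with t hstar hsmul hsmul' hf
  rw [hstar, hsmul, hsmul', Pi.smul_apply, Pi.smul_apply, hf, smul_eq_mul, smul_eq_mul, map_mul]

theorem inner_eq_inner_of_ae {f g f' g' : Lp 𝕜 2 ν}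
    (h : ∀ᵐ t ∂ν, conj (f t) * g t = conj (f' t) * g' t) : ⟪f, g⟫_𝕜 = ⟪f', g'⟫_𝕜 := by
  rw [L2.inner_def, L2.inner_def]
  exact integral_congr_ae (h.mono fun t ht => by simpa only [RCLike.inner_apply'] using ht)

theorem inner_star_star (f g : Lp 𝕜 2 ν) : ⟪star f, star g⟫_𝕜 = ⟪g, f⟫_𝕜 := by
  refine inner_eq_inner_of_ae ?_
  filter_upwards [coeFn_star_eq_conj f, coeFn_star_eq_conj g] with t hf hg
  rw [hf, hg, RCLike.conj_conj, mul_comm]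

end

/-! ### Multiplication by bounded functions -/

theorem star_bdd {b : L2} (hb : MemLp b ∞ m) : MemLp (star b : L2) ∞ m :=
  hb.star.ae_eq (Lp.coeFn_star b).symm

section
variable {b : L2} (hb : MemLp b ∞ m)

theorem coeFn_mulBdd (f : L2) : ∀ᵐ t ∂m, mulBdd b hb f t = b t * f t :=
  MemLp.coeFn_toLp _

theorem mulBdd_add (f g : L2) : mulBdd b hb (f + g) = mulBdd b hb f + mulBdd b hb g := by
  apply Lp.ext
  filter_upwards [coeFn_mulBdd hb (f + g), coeFn_mulBdd hb f, coeFn_mulBdd hb g,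
    Lp.coeFn_add f g, Lp.coeFn_add (mulBdd b hb f) (mulBdd b hb g)] with t hfg hf hg hadd hadd'
  rw [hfg, hadd, hadd', Pi.add_apply, Pi.add_apply, hf, hg, mul_add]

theorem mulBdd_smul (c : ℂ) (f : L2) : mulBdd b hb (c • f) = c • mulBdd b hb f := by
  apply Lp.ext
  filter_upwards [coeFn_mulBdd hb (c • f), coeFn_mulBdd hb f, Lp.coeFn_smul c f,
    Lp.coeFn_smul c (mulBdd b hb f)] with t hcf hf hsmul hsmul'
  rw [hcf, hsmul, hsmul', Pi.smul_apply, Pi.smul_apply, hf, smul_eq_mul, smul_eq_mul,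
    mul_left_comm]

theorem mulBdd_comm {f : L2} (hf : MemLp f ∞ m) : mulBdd b hb f = mulBdd f hf b := by
  apply Lp.ext
  filter_upwards [coeFn_mulBdd hb f, coeFn_mulBdd hf b] with t hbf hfb
  rw [hbf, hfb, mul_comm]

theorem mulBdd_bdd {f : L2} (hf : MemLp f ∞ m) : MemLp (mulBdd b hb f) ∞ m :=
  (hf.mul hb).ae_eq (EventuallyEq.symm (coeFn_mulBdd hb f))

theorem mulBdd_mulBdd {c : L2} (hc : MemLp c ∞ m) (f : L2) :
    mulBdd b hb (mulBdd c hc f) = mulBdd (mulBdd b hb c) (mulBdd_bdd hb hc) f := by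
  apply Lp.ext
  filter_upwards [coeFn_mulBdd hb (mulBdd c hc f), coeFn_mulBdd hc f,
    coeFn_mulBdd (mulBdd_bdd hb hc) f, coeFn_mulBdd hb c] with t hbcf hcf hbcf' hbc
  rw [hbcf, hcf, hbcf', hbc, mul_assoc]

theorem mulBdd_left_comm {c : L2} (hc : MemLp c ∞ m) (f : L2) :
    mulBdd b hb (mulBdd c hc f) = mulBdd c hc (mulBdd b hb f) := by
  simp only [mulBdd_mulBdd, mulBdd_comm hb hc]

theorem inner_mulBdd_star_left {f : L2} (hf : MemLp f ∞ m) (Φ : L2) :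
    ⟪mulBdd b hb (star Φ), f⟫_ℂ = ⟪b, mulBdd f hf Φ⟫_ℂ := by
  refine inner_eq_inner_of_ae ?_
  filter_upwards [coeFn_mulBdd hf Φ, coeFn_mulBdd hb (star Φ), coeFn_star_eq_conj Φ]
    with t hfΦ hbΦ hstar
  rw [hfΦ, hbΦ, hstar, map_mul, Complex.conj_conj]
  ring

theorem inner_mulBdd_mulBdd (hnorm : ∀ᵐ t ∂m, ‖b t‖ = 1) (f g : L2) :
    ⟪mulBdd b hb f, mulBdd b hb g⟫_ℂ = ⟪f, g⟫_ℂ := by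
  refine inner_eq_inner_of_ae ?_
  filter_upwards [coeFn_mulBdd hb f, coeFn_mulBdd hb g, hnorm] with t hf hg ht
  have hconj : conj (b t) * b t = 1 := by rw [Complex.conj_mul', ht, Complex.ofReal_one, one_pow]
  rw [hf, hg, map_mul]
  linear_combination (conj (f t) * g t) * hconj

theorem mulBdd_star_mulBdd (hnorm : ∀ᵐ t ∂m, ‖b t‖ = 1) (f : L2) :
    mulBdd b hb (star (mulBdd b hb f)) = star f := by
  apply Lp.ext
  filter_upwards [coeFn_mulBdd hb (star (mulBdd b hb f)), coeFn_star_eq_conj (mulBdd b hb f),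
    coeFn_mulBdd hb f, coeFn_star_eq_conj f, hnorm] with t hmul hstar hbf hf ht
  rw [hmul, hstar, hbf, hf, map_mul, ← mul_assoc, Complex.mul_conj', ht, Complex.ofReal_one,
    one_pow, one_mul]

end

/-! ### The trigonometric basis -/

/-- The function `zⁿ` on the circle, for an integer `n`, as an element of `L²`. -/
abbrev e (n : ℤ) : L2 := fourierLp 2 n

theorem norm_e_apply (n : ℤ) : ∀ᵐ t ∂m, ‖e n t‖ = 1 := by
  filter_upwards [coeFn_fourierLp 2 n] with t ht
  rw [ht, fourier_apply, Circle.norm_coe]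

theorem e_bdd (n : ℤ) : MemLp (e n) ∞ m :=
  memLp_top_of_bound (Lp.aestronglyMeasurable _) 1 ((norm_e_apply n).mono fun _ h => h.le)

theorem star_e (n : ℤ) : star (e n) = e (-n) := by
  apply Lp.ext
  filter_upwards [coeFn_star_eq_conj (e n), coeFn_fourierLp 2 n, coeFn_fourierLp 2 (-n)]
    with t hstar hn hneg
  rw [hstar, hn, hneg, fourier_neg]

theorem mulBdd_e_e (j n : ℤ) : mulBdd (e j) (e_bdd j) (e n) = e (j + n) := by
  apply Lp.ext
  filter_upwards [coeFn_mulBdd (e_bdd j) (e n), coeFn_fourierLp 2 n, coeFn_fourierLp 2 j,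
    coeFn_fourierLp 2 (j + n)] with t hmul hn hj hjn
  rw [hmul, hn, hj, hjn, fourier_add]

theorem mulBdd_e_mulBdd_e (j n : ℤ) (f : L2) :
    mulBdd (e j) (e_bdd j) (mulBdd (e n) (e_bdd n) f) = mulBdd (e (j + n)) (e_bdd _) f := by
  simp only [mulBdd_mulBdd, mulBdd_e_e]

theorem mulBdd_e_zero (f : L2) : mulBdd (e 0) (e_bdd 0) f = f := by
  apply Lp.ext
  filter_upwards [coeFn_mulBdd (e_bdd 0) f, coeFn_fourierLp 2 0] with t hf hzero
  rw [hf, hzero, fourier_zero, one_mul]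

theorem mulBdd_apply_e_zero {b : L2} (hb : MemLp b ∞ m) : mulBdd b hb (e 0) = b := by
  rw [mulBdd_comm hb (e_bdd 0), mulBdd_e_zero]

theorem mulBdd_e_neg_one (f : L2) : mulBdd z z_bdd (mulBdd (e (-1)) (e_bdd (-1)) f) = f :=
  (mulBdd_e_mulBdd_e 1 (-1) f).trans (mulBdd_e_zero f)

theorem const_eq_smul (c : ℂ) : Lp.const 2 m c = c • e 0 := by
  apply Lp.ext
  filter_upwards [coeFn_fourierLp 2 0, Lp.coeFn_const (p := 2) (μ := m) c, Lp.coeFn_smul c (e 0)]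
    with t hzero hconst hsmul
  rw [hconst, hsmul, Pi.smul_apply, hzero, fourier_zero, Function.const_apply, smul_eq_mul,
    mul_one]

theorem inner_e_mulBdd_e (n j : ℤ) (f : L2) :
    ⟪e n, mulBdd (e j) (e_bdd j) f⟫_ℂ = ⟪e (n - j), f⟫_ℂ := by
  rw [← inner_mulBdd_mulBdd (e_bdd j) (norm_e_apply j) (e (n - j)), mulBdd_e_e, add_sub_cancel]

theorem inner_e_mulBdd_z (n : ℤ) (f : L2) : ⟪e n, mulBdd z z_bdd f⟫_ℂ = ⟪e (n - 1), f⟫_ℂ :=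
  inner_e_mulBdd_e n 1 f

theorem inner_e_star (n : ℤ) (f : L2) : ⟪e n, star f⟫_ℂ = conj ⟪e (-n), f⟫_ℂ := by
  rw [inner_conj_symm, ← inner_star_star, star_star, star_e]

theorem inner_e_e (n j : ℤ) : ⟪e n, e j⟫_ℂ = if n = j then 1 else 0 :=
  orthonormal_iff_ite.1 orthonormal_fourier n j

theorem hasSum_inner_e (f g : L2) : HasSum (fun n : ℤ => ⟪f, e n⟫_ℂ * ⟪e n, g⟫_ℂ) ⟪f, g⟫_ℂ := by
  simpa only [coe_fourierBasis] using (fourierBasis (T := 1)).hasSum_inner_mul_inner f g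

/-! ### The Hardy space -/

theorem mem_H2_iff {f : L2} : f ∈ H2 ↔ ∀ n : ℤ, n < 0 → ⟪e n, f⟫_ℂ = 0 := by
  refine forall₂_congr fun n _ => ?_
  rw [← fourierBasis_repr, HilbertBasis.repr_apply_apply, coe_fourierBasis]

theorem hasSum_inner_e_nat {f g : L2} (hg : g ∈ H2) :
    HasSum (fun n : ℕ => ⟪f, e n⟫_ℂ * ⟪e n, g⟫_ℂ) ⟪f, g⟫_ℂ := by
  refine ((Nat.cast_injective (R := ℤ)).hasSum_iff fun n hn => ?_).2 (hasSum_inner_e f g)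
  have hneg : n < 0 := by
    by_contra! h
    exact hn ⟨n.toNat, Int.toNat_of_nonneg h⟩
  rw [mem_H2_iff.1 hg n hneg, mul_zero]

theorem e_mem_H2 {n : ℤ} (hn : 0 ≤ n) : e n ∈ H2 := by
  refine mem_H2_iff.2 fun j hj => ?_
  rw [inner_e_e, if_neg (by lia)]

theorem mulBdd_e_mem_H2 {j : ℤ} (hj : 0 ≤ j) {f : L2} (hf : f ∈ H2) :
    mulBdd (e j) (e_bdd j) f ∈ H2 := by
  refine mem_H2_iff.2 fun n hn => ?_
  rw [inner_e_mulBdd_e]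
  exact mem_H2_iff.1 hf _ (by lia)

theorem mulBdd_z_mem_H2 {f : L2} (hf : f ∈ H2) : mulBdd z z_bdd f ∈ H2 :=
  mulBdd_e_mem_H2 zero_le_one hf

theorem inner_star_of_mem_H2 {f ψ : L2} (hf : f ∈ H2) (hψ : ψ ∈ H2) :
    ⟪f, star ψ⟫_ℂ = ⟪f, e 0⟫_ℂ * ⟪e 0, star ψ⟫_ℂ := by
  refine (hasSum_inner_e f (star ψ)).unique (hasSum_single 0 fun n hn => ?_)
  rcases hn.lt_or_gt with hn | hn
  · rw [← inner_conj_symm, mem_H2_iff.1 hf n hn, map_zero, zero_mul]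
  · rw [inner_e_star, mem_H2_iff.1 hψ (-n) (by lia), map_zero, mul_zero]

theorem mem_H2_iff_inner_star_mulBdd_z {g : L2} :
    g ∈ H2 ↔ ∀ h ∈ H2, ⟪h, star (mulBdd z z_bdd g)⟫_ℂ = 0 := by
  refine ⟨fun hg h hh => ?_, fun h => mem_H2_iff.2 fun n hn => ?_⟩
  · rw [inner_star_of_mem_H2 hh (mulBdd_z_mem_H2 hg), inner_e_star, inner_e_mulBdd_z,
      mem_H2_iff.1 hg _ (by norm_num), map_zero, mul_zero]
  · have hcoeff := h _ (e_mem_H2 (n := -n - 1) (by lia))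
    rwa [inner_e_star, map_eq_zero, inner_e_mulBdd_z, neg_sub, sub_neg_eq_add,
      add_sub_cancel_left] at hcoeff

/-! ### The backward shift -/

/-- The backward shift `f ↦ (f - f(0)) / z`, used on `H²`; its restriction to a model space is the
adjoint of the compressed shift. -/
def backward (f : L2) : L2 :=
  mulBdd (e (-1)) (e_bdd (-1)) (f - ⟪e 0, f⟫_ℂ • e 0)

theorem mulBdd_z_backward (f : L2) : mulBdd z z_bdd (backward f) = f - ⟪e 0, f⟫_ℂ • e 0 :=
  mulBdd_e_neg_one _

theorem inner_e_backward (n : ℤ) (f : L2) :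
    ⟪e n, backward f⟫_ℂ = if n = -1 then 0 else ⟪e (n + 1), f⟫_ℂ := by
  rw [backward, inner_e_mulBdd_e, sub_neg_eq_add, inner_sub_right, inner_smul_right, inner_e_e]
  split_ifs with hzero hneg hneg
  · rw [hzero, mul_one, sub_self]
  · lia
  · lia
  · rw [mul_zero, sub_zero]

theorem backward_mem_H2 {f : L2} (hf : f ∈ H2) : backward f ∈ H2 := by
  refine mem_H2_iff.2 fun n hn => ?_
  rw [inner_e_backward]
  split_ifs with h
  · rfl
  · exact mem_H2_iff.1 hf _ (by lia)

theorem backward_bdd {f : L2} (hf : MemLp f ∞ m) : MemLp (backward f) ∞ m := by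
  refine mulBdd_bdd _ ((hf.sub ((e_bdd 0).const_smul ⟪e 0, f⟫_ℂ)).ae_eq ?_)
  exact ((Lp.coeFn_sub _ _).trans (EventuallyEq.rfl.sub (Lp.coeFn_smul _ _))).symm

theorem inner_backward_left (f : L2) {g : L2} (hg : g ∈ H2) :
    ⟪backward f, g⟫_ℂ = ⟪f, mulBdd z z_bdd g⟫_ℂ := by
  rw [← inner_mulBdd_mulBdd z_bdd (norm_e_apply 1), mulBdd_z_backward, inner_sub_left,
    inner_smul_left, inner_e_mulBdd_z, mem_H2_iff.1 hg _ (by norm_num), mul_zero, sub_zero]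

/-! ### The conjugation of a model space -/

section
variable (u : InnerFunction)

theorem mulBdd_z_C (f : L2) : mulBdd z z_bdd (C u f) = mulBdd u.toL2 u.bdd (star f) := by
  rw [C, mulBdd_left_comm, mulBdd_star_mulBdd z_bdd (norm_e_apply 1)]

theorem C_C (f : L2) : C u (C u f) = f := by
  rw [C, mulBdd_z_C, mulBdd_star_mulBdd u.bdd u.unimodular, star_star]

theorem inner_C_C (f g : L2) : ⟪C u f, C u g⟫_ℂ = ⟪g, f⟫_ℂ := by
  rw [C, C, inner_mulBdd_mulBdd u.bdd u.unimodular, inner_star_star,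
    inner_mulBdd_mulBdd z_bdd (norm_e_apply 1)]

theorem C_bdd {f : L2} (hf : MemLp f ∞ m) : MemLp (C u f) ∞ m :=
  mulBdd_bdd u.bdd (star_bdd (mulBdd_bdd z_bdd hf))

theorem coeFn_C (f : L2) : ∀ᵐ t ∂m, C u f t = u.toL2 t * (conj (z t) * conj (f t)) := by
  filter_upwards [coeFn_mulBdd u.bdd (star (mulBdd z z_bdd f)),
    coeFn_star_eq_conj (mulBdd z z_bdd f), coeFn_mulBdd z_bdd f] with t hmul hstar hf
  rw [C, hmul, hstar, hf, map_mul]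

theorem C_add (f g : L2) : C u (f + g) = C u f + C u g := by
  simp only [C, mulBdd_add, star_add_Lp]

theorem C_smul (c : ℂ) (f : L2) : C u (c • f) = conj c • C u f := by
  simp only [C, mulBdd_smul, star_smul_Lp]

theorem mulBdd_star_self : mulBdd u.toL2 u.bdd (star u.toL2) = e 0 := by
  have h := mulBdd_star_mulBdd u.bdd u.unimodular (e 0)
  rwa [mulBdd_apply_e_zero, star_e, neg_zero] at h

theorem C_backward (f : L2) :
    C u (backward f) = mulBdd z z_bdd (C u f) - conj ⟪e 0, f⟫_ℂ • u.toL2 := by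
  rw [C, mulBdd_z_backward, mulBdd_z_C, sub_eq_add_neg, ← neg_smul, star_add_Lp, star_smul_Lp,
    star_e, mulBdd_add, mulBdd_smul, neg_zero, mulBdd_apply_e_zero, map_neg, neg_smul,
    ← sub_eq_add_neg]

variable {u}

theorem mem_K_iff {f : L2} : f ∈ K u ↔ f ∈ H2 ∧ C u f ∈ H2 := by
  have inner_mulBdd (h : L2) :
      ⟪mulBdd u.toL2 u.bdd h, f⟫_ℂ = ⟪h, star (mulBdd z z_bdd (C u f))⟫_ℂ := by
    conv_lhs => rw [← C_C u f]
    exact inner_mulBdd_mulBdd u.bdd u.unimodular _ _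
  refine and_congr_right fun _ => ?_
  change f ∈ (uH2 u)ᗮ ↔ C u f ∈ H2
  rw [Submodule.mem_orthogonal, mem_H2_iff_inner_star_mulBdd_z]
  constructor
  · exact fun h g hg => (inner_mulBdd g).symm.trans (h _ ⟨g, hg, rfl⟩)
  · rintro h _ ⟨g, hg, rfl⟩
    rw [inner_mulBdd, h g hg]

theorem mem_H2_of_mem_K {f : L2} (hf : f ∈ K u) : f ∈ H2 := (mem_K_iff.1 hf).1

theorem C_mem_K {f : L2} (hf : f ∈ K u) : C u f ∈ K u := by
  rw [mem_K_iff, C_C]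
  exact (mem_K_iff.1 hf).symm

theorem backward_mem_K {f : L2} (hf : f ∈ H2) (hCf : mulBdd z z_bdd (C u f) ∈ H2) :
    backward f ∈ K u := by
  rw [mem_K_iff, C_backward]
  exact ⟨backward_mem_H2 hf, sub_mem hCf (H2.smul_mem _ u.mem_H2)⟩

theorem backward_mem_K_of_mem {f : L2} (hf : f ∈ K u) : backward f ∈ K u :=
  backward_mem_K (mem_H2_of_mem_K hf) (mulBdd_z_mem_H2 (mem_H2_of_mem_K (C_mem_K hf)))

variable (u)

theorem backward_inner_mem_K : backward u.toL2 ∈ K u := by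
  refine backward_mem_K u.mem_H2 ?_
  rw [mulBdd_z_C, mulBdd_star_self]
  exact e_mem_H2 le_rfl

/-- The conjugation `C` as a conjugate-linear map of the model space. -/
def conjugation : K u →ₗ⋆[ℂ] K u where
  toFun f := ⟨C u f, C_mem_K f.2⟩
  map_add' f g := Subtype.ext (C_add u f g)
  map_smul' c f := Subtype.ext (C_smul u c f)

theorem coe_conjugation (f : K u) : (conjugation u f : L2) = C u f := rfl

end

/-! ### The compressed shift -/

section
variable {u : InnerFunction}

theorem inner_P (g : K u) (w : L2) : ⟪g, P u w⟫_ℂ = ⟪(g : L2), w⟫_ℂ :=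
  Submodule.inner_orthogonalProjectionOnto_eq_of_mem_left g w

theorem inner_P_left (g : K u) (w : L2) : ⟪P u w, g⟫_ℂ = ⟪w, (g : L2)⟫_ℂ :=
  Submodule.inner_orthogonalProjectionOnto_eq_of_mem_right g w

theorem P_coe (g : K u) : P u (g : L2) = g :=
  Submodule.orthogonalProjectionOnto_mem_subspace_eq_self g

variable (u)

theorem P_inner_eq_zero : P u u.toL2 = 0 := by
  refine ext_inner_left ℂ fun g => ?_
  rw [inner_P, inner_zero_right, ← inner_conj_symm,
    (Submodule.mem_orthogonal _ _).1 g.2.2 _ ⟨e 0, e_mem_H2 le_rfl,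
      (mulBdd_apply_e_zero u.bdd).symm⟩, map_zero]

theorem coe_P_e_zero : (P u (e 0) : L2) = C u (backward u.toL2) := by
  have heq : e 0 = C u (backward u.toL2) + conj ⟪e 0, u.toL2⟫_ℂ • u.toL2 := by
    rw [C_backward, mulBdd_z_C, mulBdd_star_self, sub_add_cancel]
  conv_lhs => rw [heq, map_add, map_smul, P_inner_eq_zero, smul_zero, add_zero]
  exact congrArg Subtype.val (P_coe ⟨_, C_mem_K (backward_inner_mem_K u)⟩)

/-- Multiplication by `z` as a bounded operator of `L²`. -/
def mulZ : L2 →L[ℂ] L2 :=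
  LinearIsometry.toContinuousLinearMap
    { toFun := mulBdd z z_bdd
      map_add' := mulBdd_add z_bdd
      map_smul' := mulBdd_smul z_bdd
      norm_map' := fun f => by
        change ‖mulBdd z z_bdd f‖ = ‖f‖
        rw [@norm_eq_sqrt_re_inner ℂ, inner_mulBdd_mulBdd z_bdd (norm_e_apply 1),
          ← norm_eq_sqrt_re_inner] }

/-- The compressed shift `S_u` as a bounded operator of the model space. -/
def shift : K u →L[ℂ] K u := P u ∘L mulZ ∘L (K u).subtypeL

variable {u}

theorem shift_apply (f : K u) : shift u f = P u (mulBdd z z_bdd f) := rfl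

theorem adjoint_shift_apply (f : K u) :
    ((shift u)†) f = ⟨backward f, backward_mem_K_of_mem f.2⟩ := by
  refine ext_inner_right ℂ fun g => ?_
  rw [ContinuousLinearMap.adjoint_inner_left, shift_apply, inner_P, Submodule.coe_inner,
    inner_backward_left _ (mem_H2_of_mem_K g.2)]

theorem coe_adjoint_shift (f : K u) : (((shift u)†) f : L2) = backward f := by
  rw [adjoint_shift_apply]

theorem shift_conjugation (f : K u) :
    shift u (conjugation u f) = conjugation u (((shift u)†) f) := by
  have heq : mulBdd z z_bdd (C u f) =
      conjugation u (((shift u)†) f) + conj ⟪e 0, (f : L2)⟫_ℂ • u.toL2 := by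
    rw [coe_conjugation, coe_adjoint_shift, C_backward, sub_add_cancel]
  rw [shift_apply, coe_conjugation, heq, map_add, map_smul, P_inner_eq_zero, smul_zero, add_zero,
    P_coe]

theorem shift_adjoint_shift (f : K u) :
    shift u (((shift u)†) f) = f - ⟪P u (e 0), f⟫_ℂ • P u (e 0) := by
  rw [shift_apply, coe_adjoint_shift, mulBdd_z_backward, map_sub, map_smul, P_coe, inner_P_left]

theorem shift_P (w : L2) :
    shift u (P u w) = P u (mulBdd z z_bdd w) - ⟪e (-1), w⟫_ℂ • P u (e 0) := by
  refine ext_inner_left ℂ fun g => ?_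
  rw [← ContinuousLinearMap.adjoint_inner_left, inner_P, coe_adjoint_shift,
    ← inner_mulBdd_mulBdd z_bdd (norm_e_apply 1), mulBdd_z_backward, inner_sub_left,
    inner_smul_left, inner_e_mulBdd_z, inner_sub_right, inner_P, inner_smul_right (E := K u),
    inner_P, inner_conj_symm, zero_sub, mul_comm]

theorem coe_adjoint_shift_iterate (f : K u) (n : ℕ) :
    ((((shift u)†)^[n] f : K u) : L2) = backward^[n] f :=
  Function.Semiconj.iterate_right (f := Subtype.val) (ga := (shift u)†) coe_adjoint_shift n f

end

theorem inner_backward_iterate (f : L2) (n : ℕ) {g : L2} (hg : g ∈ H2) :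
    ⟪backward^[n] f, g⟫_ℂ = ⟪f, mulBdd (e n) (e_bdd n) g⟫_ℂ := by
  induction n generalizing g with
  | zero => exact congrArg (inner ℂ f) (mulBdd_e_zero g).symm
  | succ n ih =>
    rw [Function.iterate_succ_apply', inner_backward_left _ hg, ih (mulBdd_z_mem_H2 hg)]
    exact congrArg (inner ℂ f) (mulBdd_e_mulBdd_e n 1 g)

theorem inner_e_backward_iterate (f : L2) (j n : ℕ) :
    ⟪e j, backward^[n] f⟫_ℂ = ⟪e (n + j), f⟫_ℂ := by
  rw [← inner_conj_symm, inner_backward_iterate f n (e_mem_H2 (Int.natCast_nonneg j)), mulBdd_e_e,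
    inner_conj_symm]

theorem iterate_backward_mem_H2 {f : L2} (hf : f ∈ H2) (n : ℕ) : backward^[n] f ∈ H2 :=
  Set.MapsTo.iterate (f := backward) (s := (H2 : Set L2)) (fun _ => backward_mem_H2) n hf

theorem tendsto_backward_iterate {f : L2} (hf : f ∈ H2) :
    Tendsto (fun n => backward^[n] f) atTop (𝓝 0) := by
  have inner_self (n : ℕ) : ⟪backward^[n] f, backward^[n] f⟫_ℂ =
      ∑' j : ℕ, ⟪f, e ((j + n : ℕ) : ℤ)⟫_ℂ * ⟪e ((j + n : ℕ) : ℤ), f⟫_ℂ := by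
    rw [← (hasSum_inner_e_nat (iterate_backward_mem_H2 hf n)).tsum_eq]
    refine tsum_congr fun j => ?_
    rw [← inner_conj_symm, inner_e_backward_iterate, inner_conj_symm, Nat.cast_add, add_comm]
  have tendsto_inner : Tendsto (fun n => ⟪backward^[n] f, backward^[n] f⟫_ℂ) atTop (𝓝 0) := by
    simp only [inner_self]
    exact tendsto_sum_nat_add fun j : ℕ => ⟪f, e j⟫_ℂ * ⟪e j, f⟫_ℂ
  rw [tendsto_zero_iff_norm_tendsto_zero]
  simp only [norm_eq_sqrt_re_inner (𝕜 := ℂ)]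
  simpa only [Function.comp_apply, map_zero, Real.sqrt_zero] using
    ((RCLike.continuous_re.tendsto (0 : ℂ)).comp tendsto_inner).sqrt

theorem tendsto_adjoint_shift_iterate {u : InnerFunction} (f : K u) :
    Tendsto (fun n => ((shift u)†)^[n] f) atTop (𝓝 0) := by
  rw [tendsto_subtype_rng]
  simp only [coe_adjoint_shift_iterate]
  exact tendsto_backward_iterate (mem_H2_of_mem_K f.2)

/-- The compressed shift and the conjugation of a model space. The defect vector `P_u 1` is the
reproducing kernel of `K_u` at the origin. -/
def modelShift (u : InnerFunction) : ConjugatedShift ℂ (K u) where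
  S := shift u
  C := conjugation u
  k := P u (e 0)
  C_C f := Subtype.ext (C_C u f)
  inner_C_C f g := inner_C_C u f g
  S_C := shift_conjugation
  S_adjoint := shift_adjoint_shift
  tendsto_adjoint_iterate := tendsto_adjoint_shift_iterate

theorem nontrivial_K {u : InnerFunction} (hu : ¬ u.IsConstant) : Nontrivial (K u) := by
  refine nontrivial_of_ne ⟨_, backward_inner_mem_K u⟩ 0 fun hzero => hu ⟨⟪e 0, u.toL2⟫_ℂ, ?_⟩
  have hbackward : backward u.toL2 = 0 := congrArg Subtype.val hzero
  have hz := mulBdd_z_backward u.toL2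
  rw [hbackward, ← zero_smul ℂ (0 : L2), mulBdd_smul, zero_smul] at hz
  rw [const_eq_smul, ← sub_eq_zero, ← hz]

/-! ### Density of the bounded functions -/

/-- The bounded functions of the model space, on which truncated Toeplitz operators are defined. -/
def boundedFunctions (u : InnerFunction) : Submodule ℂ (K u) where
  carrier := {f | MemLp (f : L2) ∞ m}
  zero_mem' := MemLp.zero.ae_eq (Lp.coeFn_zero ℂ 2 m).symm
  add_mem' {f g} hf hg := (MemLp.add hf hg).ae_eq (Lp.coeFn_add (f : L2) g).symm
  smul_mem' c f hf := (MemLp.const_smul hf c).ae_eq (Lp.coeFn_smul c (f : L2)).symm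

theorem shift_mem_boundedFunctions {u : InnerFunction} {f : K u} (hf : f ∈ boundedFunctions u) :
    shift u f ∈ boundedFunctions u := by
  have heq : (shift u f : L2) = C u (backward (C u f)) := by
    conv_lhs => rw [← (modelShift u).C_C f]
    change (shift u (conjugation u (conjugation u f)) : L2) = _
    rw [shift_conjugation, coe_conjugation, coe_adjoint_shift, coe_conjugation]
  change MemLp (shift u f : L2) ∞ m
  rw [heq]
  exact C_bdd u (backward_bdd (C_bdd u hf))

theorem dense_boundedFunctions (u : InnerFunction) : Dense (boundedFunctions u : Set (K u)) := by
  refine (modelShift u).dense_of_invariant ?_ fun f => shift_mem_boundedFunctions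
  change MemLp (P u (e 0) : L2) ∞ m
  rw [coe_P_e_zero]
  exact C_bdd u (backward_bdd u.bdd)

/-! ### Symbols and displacement equations -/

section
variable {u : InnerFunction} {A : K u →L[ℂ] K u} {Φ : L2}

theorem HasSymbol.inner_apply (h : HasSymbol u A Φ) {f : K u} (hf : MemLp (f : L2) ∞ m) (g : K u) :
    ⟪g, A f⟫_ℂ = ⟪(g : L2), mulBdd (f : L2) hf Φ⟫_ℂ := by
  rw [h f hf, truncatedToeplitz, inner_P]

theorem hasSymbol_of_inner (h : ∀ (f g : K u) (hf : MemLp (f : L2) ∞ m), MemLp (g : L2) ∞ m →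
    ⟪g, A f⟫_ℂ = ⟪(g : L2), mulBdd (f : L2) hf Φ⟫_ℂ) : HasSymbol u A Φ := by
  intro f hf
  refine (dense_boundedFunctions u).eq_of_inner_right ℂ fun g hg => ?_
  rw [h f g hf hg, truncatedToeplitz, inner_P]

theorem HasSymbol.smul (hA : HasSymbol u A Φ) (c : ℂ) : HasSymbol u (c • A) (c • Φ) := by
  intro f hf
  rw [smul_apply, hA f hf, truncatedToeplitz, truncatedToeplitz, mulBdd_smul, map_smul]

theorem hasSymbol_sub_smul_id {c : ℂ} :
    HasSymbol u (A - c • ContinuousLinearMap.id ℂ (K u)) Φ ↔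
      HasSymbol u A (Φ + Lp.const 2 m c) := by
  refine forall₂_congr fun f hf => ?_
  rw [truncatedToeplitz, truncatedToeplitz, mulBdd_add, const_eq_smul, mulBdd_smul,
    mulBdd_apply_e_zero, map_add, map_smul, P_coe]
  exact sub_eq_iff_eq_add

theorem HasSymbol.isComplexSymmetric (h : HasSymbol u A Φ) :
    (modelShift u).IsComplexSymmetric A := by
  refine (modelShift u).isComplexSymmetric_of_dense (dense_boundedFunctions u)
    fun f (hf : MemLp (f : L2) ∞ m) g (hg : MemLp (g : L2) ∞ m) => ?_
  change ⟪g, A (conjugation u f)⟫_ℂ = ⟪f, A (conjugation u g)⟫_ℂ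
  rw [h.inner_apply (f := conjugation u f) (C_bdd u hf),
    h.inner_apply (f := conjugation u g) (C_bdd u hg)]
  simp only [coe_conjugation]
  refine inner_eq_inner_of_ae ?_
  filter_upwards [coeFn_mulBdd (C_bdd u hf) Φ, coeFn_mulBdd (C_bdd u hg) Φ, coeFn_C u f,
    coeFn_C u g] with t hfΦ hgΦ hCf hCg
  rw [hfΦ, hgΦ, hCf, hCg]
  ring

theorem mulBdd_z_mulBdd_backward {f : L2} (hf : MemLp f ∞ m) (Φ : L2) :
    mulBdd z z_bdd (mulBdd (backward f) (backward_bdd hf) Φ) =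
      mulBdd f hf Φ - ⟪e 0, f⟫_ℂ • Φ := by
  apply Lp.ext
  filter_upwards [coeFn_mulBdd z_bdd (mulBdd (backward f) (backward_bdd hf) Φ),
    coeFn_mulBdd (backward_bdd hf) Φ, coeFn_mulBdd z_bdd (backward f), coeFn_mulBdd hf Φ,
    Lp.coeFn_sub f (⟪e 0, f⟫_ℂ • e 0), Lp.coeFn_smul ⟪e 0, f⟫_ℂ (e 0), coeFn_fourierLp 2 0,
    Lp.coeFn_sub (mulBdd f hf Φ) (⟪e 0, f⟫_ℂ • Φ), Lp.coeFn_smul ⟪e 0, f⟫_ℂ Φ]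
    with t hmul hback hzback hfΦ hsub hsmul hone hsub' hsmul'
  rw [mulBdd_z_backward, hsub, Pi.sub_apply, hsmul, Pi.smul_apply, hone, fourier_zero, smul_eq_mul,
    mul_one] at hzback
  rw [hmul, hback, hsub', Pi.sub_apply, hfΦ, hsmul', Pi.smul_apply, smul_eq_mul, ← mul_assoc,
    ← hzback, sub_mul]

theorem HasSymbol.hasDisplacement (h : HasSymbol u A Φ) :
    (modelShift u).HasDisplacement A (P u Φ - ⟪e 0, Φ⟫_ℂ • P u (e 0)) (P u (star Φ)) := by
  refine ConjugatedShift.hasDisplacement_of_dense (dense_boundedFunctions u)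
    fun f (hf : MemLp (f : L2) ∞ m) => ?_
  change A f - shift u (A (((shift u)†) f)) = ⟪P u (e 0), f⟫_ℂ • _ + ⟪P u (star Φ), f⟫_ℂ • P u (e 0)
  have inner_e_neg_one : ⟪e (-1), mulBdd (backward f) (backward_bdd hf) Φ⟫_ℂ =
      ⟪star Φ, (f : L2)⟫_ℂ - ⟪e 0, (f : L2)⟫_ℂ * ⟪e 0, Φ⟫_ℂ := by
    rw [← zero_sub, ← inner_e_mulBdd_z, mulBdd_z_mulBdd_backward hf, inner_sub_right,
      inner_smul_right, ← inner_mulBdd_star_left (e_bdd 0) hf, mulBdd_e_zero]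
  rw [adjoint_shift_apply, h f hf, h ⟨backward f, _⟩ (backward_bdd hf), truncatedToeplitz,
    truncatedToeplitz, shift_P, mulBdd_z_mulBdd_backward hf, inner_e_neg_one, map_sub, map_smul,
    inner_P_left, inner_P_left]
  module

theorem hasSum_symbol {f g : K u} (hf : MemLp (f : L2) ∞ m) (hg : MemLp (g : L2) ∞ m) (φ : K u) :
    HasSum (fun j : ℕ => ⟪P u (e 0), ((shift u)†)^[j] f⟫_ℂ * ⟪((shift u)†)^[j] g, φ⟫_ℂ)
      ⟪(g : L2), mulBdd (f : L2) hf φ⟫_ℂ := by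
  have h := hasSum_inner_e_nat (f := mulBdd (g : L2) hg (star (φ : L2))) (mem_H2_of_mem_K f.2)
  rw [inner_mulBdd_star_left hg hf] at h
  refine h.congr_fun fun j => ?_
  rw [inner_P_left, Submodule.coe_inner, coe_adjoint_shift_iterate, coe_adjoint_shift_iterate,
    inner_backward_iterate _ _ (mem_H2_of_mem_K φ.2), inner_mulBdd_star_left hg (e_bdd j),
    ← Nat.cast_zero, inner_e_backward_iterate, Nat.cast_zero, add_zero, mul_comm]

theorem hasSymbol_of_hasDisplacement {φ χ : K u} (h : (modelShift u).HasDisplacement A φ χ) :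
    HasSymbol u A ((φ : L2) + star (χ : L2)) := by
  refine hasSymbol_of_inner fun f g hf hg => ?_
  have hφ := hasSum_symbol hf hg φ
  have hχ := Complex.hasSum_conj'.2 (hasSum_symbol hg hf χ)
  rw [inner_conj_symm, ← star_star (χ : L2), inner_mulBdd_star_left hg hf] at hχ
  rw [mulBdd_add, inner_add_right]
  refine tendsto_nhds_unique (h.tendsto_sum f g) ((hφ.add hχ).tendsto_sum_nat.congr fun n => ?_)
  refine Finset.sum_congr rfl fun j _ => congrArg _ ?_
  rw [map_mul, mul_comm, inner_conj_symm (E := K u), inner_conj_symm (E := K u)]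
  rfl

theorem P_star_of_mem_H2 {ψ : L2} (hψ : ψ ∈ H2) :
    P u (star ψ) = ⟪e 0, star ψ⟫_ℂ • P u (e 0) := by
  refine ext_inner_left ℂ fun g => ?_
  rw [inner_P, inner_star_of_mem_H2 (mem_H2_of_mem_K g.2) hψ, inner_smul_right (E := K u), inner_P,
    mul_comm]

theorem hasDisplacement_iff_hasSymbol {φ χ : K u} :
    (modelShift u).HasDisplacement A φ χ ↔ HasSymbol u A ((φ : L2) + star (χ : L2)) := by
  refine ⟨hasSymbol_of_hasDisplacement, fun h => ?_⟩
  convert h.hasDisplacement.gauge (-⟪e 0, (φ : L2)⟫_ℂ) using 1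
  · rw [map_add, inner_add_right, P_star_of_mem_H2 (mem_H2_of_mem_K χ.2), P_coe]
    change φ = _ - _ • P u (e 0)
    module
  · rw [star_add_Lp, star_star, map_add, P_star_of_mem_H2 (mem_H2_of_mem_K φ.2), P_coe,
      inner_e_star, neg_zero, map_neg]
    change χ = _ + _ • P u (e 0)
    module

theorem isOfType_iff {α : OnePoint ℂ} : IsOfType u A α ↔ (modelShift u).IsOfType A α := by
  induction α using OnePoint.rec with
  | infty =>
    constructor
    · rintro ⟨ψ, hψ, h⟩
      have hdisp := h.hasDisplacement
      rw [P_star_of_mem_H2 hψ, sub_self] at hdisp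
      exact ⟨_, hdisp⟩
    · rintro ⟨χ, h⟩
      refine ⟨χ, mem_H2_of_mem_K χ.2, ?_⟩
      simpa only [ZeroMemClass.coe_zero, zero_add] using hasDisplacement_iff_hasSymbol.1 h
  | coe α =>
    refine exists_congr fun φ => exists_congr fun c => ?_
    have hstar : α • star (S u (C u φ) : L2) = star ((conj α • S u (C u φ) : K u) : L2) := by
      rw [Submodule.coe_smul, star_smul_Lp, Complex.conj_conj]
    rw [hstar, ← hasSymbol_sub_smul_id, ← hasDisplacement_iff_hasSymbol,
      ConjugatedShift.hasDisplacement_sub_smul_id]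
    rfl

theorem IsTTO.isComplexSymmetric (h : IsTTO u A) : (modelShift u).IsComplexSymmetric A :=
  h.elim fun _ => HasSymbol.isComplexSymmetric

theorem isTTO_iff_exists_hasDisplacement :
    IsTTO u A ↔ ∃ φ χ, (modelShift u).HasDisplacement A φ χ :=
  ⟨fun ⟨_, h⟩ => ⟨_, _, h.hasDisplacement⟩, fun ⟨_, _, h⟩ => ⟨_, hasSymbol_of_hasDisplacement h⟩⟩

end

/-! ### Products of truncated Toeplitz operators -/

section
variable {u : InnerFunction} {A B : K u →L[ℂ] K u}

theorem IsTTO.comp_of_isOfType (hA : IsTTO u A) (hB : IsTTO u B) [Nontrivial (K u)]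
    {α : OnePoint ℂ} (hAα : IsOfType u A α) (hBα : IsOfType u B α) : IsTTO u (A ∘L B) :=
  isTTO_iff_exists_hasDisplacement.2 ((isOfType_iff.1 hAα).exists_hasDisplacement_comp
    (isOfType_iff.1 hBα) hA.isComplexSymmetric hB.isComplexSymmetric)

theorem IsTTO.isOfType_comp (hA : IsTTO u A) (hB : IsTTO u B) [Nontrivial (K u)]
    {α : OnePoint ℂ} (hAα : IsOfType u A α) (hBα : IsOfType u B α) : IsOfType u (A ∘L B) α :=
  isOfType_iff.2 <| (isOfType_iff.1 hAα).comp (isOfType_iff.1 hBα) hA.isComplexSymmetric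
    hB.isComplexSymmetric <| hA.isComplexSymmetric.commute hB.isComplexSymmetric
      (hA.comp_of_isOfType hB hAα hBα).isComplexSymmetric

theorem IsTTO.scalar_or_isOfType_of_comp (hA : IsTTO u A) (hB : IsTTO u B) [Nontrivial (K u)]
    (hAB : IsTTO u (A ∘L B)) :
    ((∃ c : ℂ, A = c • ContinuousLinearMap.id ℂ (K u)) ∨
      ∃ c : ℂ, B = c • ContinuousLinearMap.id ℂ (K u)) ∨
    ∃ α : OnePoint ℂ, IsOfType u A α ∧ IsOfType u B α := by
  obtain ⟨_, _, hAdisp⟩ := isTTO_iff_exists_hasDisplacement.1 hA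
  obtain ⟨_, _, hBdisp⟩ := isTTO_iff_exists_hasDisplacement.1 hB
  obtain ⟨_, _, hABdisp⟩ := isTTO_iff_exists_hasDisplacement.1 hAB
  simpa only [isOfType_iff] using hAdisp.isOfType_of_comp hBdisp hABdisp hA.isComplexSymmetric
    hB.isComplexSymmetric

end

end TTO

end

theorem mainTheorem1 (u : TTO.InnerFunction) (hu : ¬ u.IsConstant)
    (Φ Ψ : TTO.L2) (AΦ AΨ : TTO.K u →L[ℂ] TTO.K u)
    (hΦ : TTO.HasSymbol u AΦ Φ) (hΨ : TTO.HasSymbol u AΨ Ψ) :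
    (TTO.IsTTO u (AΦ ∘L AΨ) ↔
      ((∃ c : ℂ, AΦ = c • ContinuousLinearMap.id ℂ (TTO.K u)) ∨
        (∃ c : ℂ, AΨ = c • ContinuousLinearMap.id ℂ (TTO.K u))) ∨
      (∃ α : OnePoint ℂ, TTO.IsOfType u AΦ α ∧ TTO.IsOfType u AΨ α)) ∧
    (∀ α : OnePoint ℂ, TTO.IsOfType u AΦ α → TTO.IsOfType u AΨ α →
      TTO.IsOfType u (AΦ ∘L AΨ) α) := by
  have := TTO.nontrivial_K hu
  have hAΦ : TTO.IsTTO u AΦ := ⟨Φ, hΦ⟩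
  have hAΨ : TTO.IsTTO u AΨ := ⟨Ψ, hΨ⟩
  refine ⟨⟨hAΦ.scalar_or_isOfType_of_comp hAΨ, ?_⟩, fun _ => hAΦ.isOfType_comp hAΨ⟩
  rintro ((⟨c, rfl⟩ | ⟨c, rfl⟩) | ⟨_, hα⟩)
  · exact ⟨c • Ψ, hΨ.smul c⟩
  · refine ⟨c • Φ, ?_⟩
    rw [ContinuousLinearMap.comp_smul, ContinuousLinearMap.comp_id]
    exact hΦ.smul c
  · exact hAΦ.comp_of_isOfType hAΨ hα.1 hα.2
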